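/- Let $\{\alpha_n\}_{n\ge 0}$ be a sequence of complex numbers and $N$ a natural number such that $|\alpha_n|\ne 1$ for $0\le n\le N-1$ and $|\alpha_n|<1$ for $n\ge N$. Let $\{\Phi_n\}_{n\ge 0}$ be the monic polynomials defined by the Szegő recurrence $\Phi_0=1$, $\Phi_{n+1}(z)=z\Phi_n(z)-\overline{\alpha_n}\,\Phi_n^*(z)$, where $\Phi_n^*(z)=z^n\overline{\Phi_n(1/\overline z)}$. Write $\Phi_n(z)=z^n+\sum_{j=0}^{n-1}t_{n,j}z^j$ and define a linear functional $\mu$ on the space of Laurent polynomials by $\mu(1)=1$ and, for $n\ge 1$, \[ \mu(z^n)=-\sum_{j=0}^{n-1}t_{n,j}\,\mu(z^j),\qquad \mu(z^{-n})=\overline{\mu(z^n)}. \] Then \[ \limsup_{n\to\infty}|\mu(z^n)|^{1/n}<\infty . \] Moreover, the numbers $\mu(z^{-n})$ are, up to a factor $2$, the Maclaurin coefficients of the following function $F$. Let $\mathbb D=\{|z|<1\}$. There is a sequence $\{f_n\}_{n\ge 0}$ of functions on $\mathbb D$ such that for $n\ge N$ the function $f_n$ is analytic with $|f_n|\le 1$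 on $\mathbb D$, for $n<N$ it is meromorphic on $\mathbb D$, and for all $n\ge 0$ \[ f_n(z)=\frac{\alpha_n+zf_{n+1}(z)}{1+\overline{\alpha_n}\,zf_{n+1}(z)},\qquad z\in\mathbb D \] (as an identity of meromorphic functions when $n<N$). For every such sequence, the function $F(z)=\dfrac{1+zf_0(z)}{1-zf_0(z)}$ is analytic at $0$, $F(0)=1$, and \[ \frac{F^{(n)}(0)}{n!}=2\,\mu(z^{-n}),\qquad n\ge 1 . \] -/

import Mathlib

open Polynomial LaurentPolynomial Filter Topology ComplexConjugate

noncomputable section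

/-- The condition on the Verblunsky coefficients: none of the first `N` coefficients is unimodular,
and all the others lie in the open unit disk. -/
def IsAdmissibleVerblunsky (α : ℕ → ℂ) (N : ℕ) : Prop :=
  (∀ n, n < N → ‖α n‖ ≠ 1) ∧ ∀ n, N ≤ n → ‖α n‖ < 1

/-- The reversed polynomial of degree `n`: `P^*(z) = z ^ n * conj (P (1 / conj z))`. -/
def szegoReverse (n : ℕ) (P : ℂ[X]) : ℂ[X] :=
  (P.map (starRingEnd ℂ)).reflect n

/-- The polynomials `Φ_n` generated by the Szegő recurrence
`Φ_{n+1}(z) = z Φ_n(z) - conj (α_n) Φ_n^*(z)` with `Φ_0 = 1`. -/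
def szegoPoly (α : ℕ → ℂ) : ℕ → ℂ[X]
  | 0 => 1
  | n + 1 => X * szegoPoly α n - Polynomial.C (conj (α n)) * szegoReverse n (szegoPoly α n)

/-- The values `μ(z ^ n)`, `n ≥ 0`: `μ(1) = 1` and `μ(z ^ n) = -∑_{j < n} t_j μ(z ^ j)`, where
`Φ_n(z) = z ^ n + ∑_{j < n} t_j z ^ j`. -/
def szegoMoment (α : ℕ → ℂ) (n : ℕ) : ℂ :=
  if n = 0 then 1 else -∑ j : Fin n, (szegoPoly α n).coeff j * szegoMoment α j
termination_by n
decreasing_by exact j.isLt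

/-- The values of `μ` at all integer powers of `z`, with `μ(z ^ (-n)) = conj (μ(z ^ n))`. -/
def szegoMomentInt (α : ℕ → ℂ) : ℤ → ℂ
  | Int.ofNat n => szegoMoment α n
  | Int.negSucc n => conj (szegoMoment α (n + 1))

/-- The linear functional `μ` on the space of Laurent polynomials. -/
def szegoFunctional (α : ℕ → ℂ) : ℂ[T;T⁻¹] →ₗ[ℂ] ℂ where
  toFun p := p.coeff.sum fun k c => c * szegoMomentInt α k
  map_add' p q := by
    rw [AddMonoidAlgebra.coeff_add]
    exact Finsupp.sum_add_index' (by simp) (by intros; ring)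
  map_smul' c p := by
    rw [AddMonoidAlgebra.coeff_smul, Finsupp.sum_smul_index (by simp)]
    simp [Finsupp.mul_sum, mul_assoc]

theorem szegoFunctional_T (α : ℕ → ℂ) (k : ℤ) :
    szegoFunctional α (T k) = szegoMomentInt α k := by
  change ((AddMonoidAlgebra.single k (1 : ℂ)).coeff.sum fun k c => c * szegoMomentInt α k) = _
  rw [AddMonoidAlgebra.coeff_single, Finsupp.sum_single_index] <;> simp

theorem szegoFunctional_one (α : ℕ → ℂ) : szegoFunctional α 1 = 1 := by
  rw [← T_zero, szegoFunctional_T]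
  change szegoMoment α 0 = 1
  rw [szegoMoment]
  simp

theorem szegoFunctional_T_natCast (α : ℕ → ℂ) (n : ℕ) (hn : 1 ≤ n) :
    szegoFunctional α (T (n : ℤ)) =
      -∑ j ∈ Finset.range n, (szegoPoly α n).coeff j * szegoFunctional α (T (j : ℤ)) := by
  simp only [szegoFunctional_T]
  change szegoMoment α n =
    -∑ j ∈ Finset.range n, (szegoPoly α n).coeff j * szegoMoment α j
  rw [szegoMoment, if_neg (by omega),
    Fin.sum_univ_eq_sum_range (fun j => (szegoPoly α n).coeff j * szegoMoment α j) n]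

theorem szegoFunctional_T_neg (α : ℕ → ℂ) (n : ℕ) (hn : 1 ≤ n) :
    szegoFunctional α (T (-(n : ℤ))) = conj (szegoFunctional α (T (n : ℤ))) := by
  obtain ⟨m, rfl⟩ : ∃ m, n = m + 1 := ⟨n - 1, by omega⟩
  simp only [szegoFunctional_T]
  rfl

/-- `f` is the sequence of functions on the unit disk attached to `α`. For `n ≥ N` the `f_n` are
the Schur functions (analytic in the disk and bounded by `1`) whose Schur parameters are
`α_n, α_{n+1}, …`, i.e. which satisfy
`f_n(z) = (α_n + z f_{n+1}(z)) / (1 + conj (α_n) z f_{n+1}(z))`.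
For `n < N` the `f_n` are meromorphic in the disk and obtained from `f_N` by iterating the same
relation; as these functions may have poles, there the relation is an identity of meromorphic
functions, i.e. it holds off a set without accumulation points in the disk. -/
structure IsSchurSequence (α : ℕ → ℂ) (N : ℕ) (f : ℕ → ℂ → ℂ) : Prop where
  differentiableOn : ∀ n, N ≤ n → DifferentiableOn ℂ (f n) (Metric.ball 0 1)
  norm_le_one : ∀ n, N ≤ n → ∀ z ∈ Metric.ball (0 : ℂ) 1, ‖f n z‖ ≤ 1
  recursion : ∀ n, N ≤ n → ∀ z ∈ Metric.ball (0 : ℂ) 1,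
    f n z = (α n + z * f (n + 1) z) / (1 + conj (α n) * z * f (n + 1) z)
  meromorphicOn : ∀ n, n < N → MeromorphicOn (f n) (Metric.ball 0 1)
  recursion_of_lt : ∀ n, n < N → ∀ᶠ z in codiscreteWithin (Metric.ball (0 : ℂ) 1),
    f n z = (α n + z * f (n + 1) z) / (1 + conj (α n) * z * f (n + 1) z)

/-- The function `F(z) = (1 + z f(z)) / (1 - z f(z))`, where `f = f_0`. -/
def caratheodoryF (f : ℕ → ℂ → ℂ) (z : ℂ) : ℂ :=
  (1 + z * f 0 z) / (1 - z * f 0 z)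

end

/-! Let `Ψ_n` be the Szegő polynomials of `-α`. Near `0`, with `g_n` the analytic germ of `f_n`,
induction gives `F Φ_n + Ψ_n = z^n a_n` and `F Φ_n^* - Ψ_n^* = z^(n+1) g_n a_n`. The coefficient of
`z^n` in the second relation says that `1` followed by the conjugated, halved Taylor coefficients of
`F` is annihilated by `Φ_n`; by `eq_szegoMoment` such a sequence is the moment sequence. Cauchy's
estimates for `F` then bound the limsup.

A Schur sequence exists because Schur steps contract the pseudo-hyperbolic distance uniformly on
`|z| ≤ R < 1`, so the approximants started at `0` converge; finitely many further steps give the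
meromorphic `f_n`, `n < N`. -/

/-! ### Szegő polynomials, their reversals and the moments -/

theorem natDegree_szegoReverse_le {n : ℕ} {P : ℂ[X]} (hP : P.natDegree ≤ n) :
    (szegoReverse n P).natDegree ≤ n := by
  have h : (P.map (starRingEnd ℂ)).natDegree ≤ n := natDegree_map_le.trans hP
  exact natDegree_reflect_le.trans (max_le le_rfl h)

theorem natDegree_szegoPoly_le (α : ℕ → ℂ) (n : ℕ) : (szegoPoly α n).natDegree ≤ n := by
  induction n with
  | zero => simp [szegoPoly]
  | succ n ih =>
    rw [szegoPoly]
    refine (natDegree_sub_le _ _).trans (max_le ?_ ?_)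
    · exact natDegree_mul_le.trans (by rw [natDegree_X]; omega)
    · exact (natDegree_C_mul_le _ _).trans ((natDegree_szegoReverse_le ih).trans n.le_succ)

theorem coeff_szegoReverse {n k : ℕ} (hk : k ≤ n) (P : ℂ[X]) :
    (szegoReverse n P).coeff k = conj (P.coeff (n - k)) := by
  rw [szegoReverse, coeff_reflect, revAt_le hk, coeff_map]

theorem szegoReverse_szegoReverse (n : ℕ) (P : ℂ[X]) :
    szegoReverse n (szegoReverse n P) = P := by
  ext k
  simp only [szegoReverse, coeff_reflect, coeff_map, revAt_invol, Complex.conj_conj]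

theorem szegoReverse_X_mul {n : ℕ} {P : ℂ[X]} (hP : P.natDegree ≤ n) :
    szegoReverse (n + 1) (X * P) = szegoReverse n P := by
  have h := reflect_mul (X : ℂ[X]) (P.map (starRingEnd ℂ)) (F := 1) natDegree_X_le
    (natDegree_map_le.trans hP)
  rw [szegoReverse, szegoReverse, Polynomial.map_mul, map_X, add_comm n 1, h]
  simp

theorem szegoReverse_succ {n : ℕ} {P : ℂ[X]} (hP : P.natDegree ≤ n) :
    szegoReverse (n + 1) P = X * szegoReverse n P := by
  have h := szegoReverse_X_mul (natDegree_szegoReverse_le hP)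
  rw [szegoReverse_szegoReverse] at h
  rw [← szegoReverse_szegoReverse (n + 1) (X * szegoReverse n P), h]

theorem szegoReverse_sub (n : ℕ) (P Q : ℂ[X]) :
    szegoReverse n (P - Q) = szegoReverse n P - szegoReverse n Q := by
  simp [szegoReverse, reflect_sub]

theorem szegoReverse_C_mul (n : ℕ) (c : ℂ) (P : ℂ[X]) :
    szegoReverse n (Polynomial.C c * P) = Polynomial.C (conj c) * szegoReverse n P := by
  simp [szegoReverse, reflect_C_mul]

/-- Reversing the Szegő recurrence closes it into a linear system for the pair `Φ_n`, `Φ_n^*`. -/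
theorem szegoReverse_szegoPoly_succ (α : ℕ → ℂ) (n : ℕ) :
    szegoReverse (n + 1) (szegoPoly α (n + 1)) =
      szegoReverse n (szegoPoly α n) - Polynomial.C (α n) * (X * szegoPoly α n) := by
  have h := natDegree_szegoPoly_le α n
  rw [szegoPoly, szegoReverse_sub, szegoReverse_X_mul h, szegoReverse_C_mul, Complex.conj_conj,
    szegoReverse_succ (natDegree_szegoReverse_le h), szegoReverse_szegoReverse]

theorem coeff_szegoPoly_self (α : ℕ → ℂ) (n : ℕ) : (szegoPoly α n).coeff n = 1 := by
  induction n with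
  | zero => simp [szegoPoly]
  | succ n ih =>
    rw [szegoPoly, coeff_sub, coeff_X_mul, ih, coeff_C_mul, coeff_eq_zero_of_natDegree_lt
      ((natDegree_szegoReverse_le (natDegree_szegoPoly_le α n)).trans_lt n.lt_succ_self)]
    simp

theorem coeff_zero_szegoPoly_succ (α : ℕ → ℂ) (n : ℕ) :
    (szegoPoly α (n + 1)).coeff 0 = -conj (α n) := by
  rw [szegoPoly, coeff_sub, coeff_C_mul, coeff_szegoReverse n.zero_le, Nat.sub_zero,
    coeff_szegoPoly_self]
  simp

theorem szegoMoment_zero (α : ℕ → ℂ) : szegoMoment α 0 = 1 := by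
  rw [szegoMoment, if_pos rfl]

theorem szegoMoment_succ (α : ℕ → ℂ) (n : ℕ) :
    szegoMoment α (n + 1) =
      -∑ j ∈ Finset.range (n + 1), (szegoPoly α (n + 1)).coeff j * szegoMoment α j := by
  rw [szegoMoment, if_neg n.succ_ne_zero,
    Fin.sum_univ_eq_sum_range (fun j => (szegoPoly α (n + 1)).coeff j * szegoMoment α j)]

/-- A sequence starting with `1` that is annihilated by the coefficients of all the `Φ_n`, `n ≥ 1`,
is the sequence of moments. -/
theorem eq_szegoMoment {α m : ℕ → ℂ} (h0 : m 0 = 1)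
    (h : ∀ n, ∑ j ∈ Finset.range (n + 2), (szegoPoly α (n + 1)).coeff j * m j = 0) (n : ℕ) :
    m n = szegoMoment α n := by
  induction n using Nat.strong_induction_on with
  | _ n ih =>
    cases n with
    | zero => rw [h0, szegoMoment_zero]
    | succ n =>
      have := h n
      rw [Finset.sum_range_succ, coeff_szegoPoly_self, one_mul] at this
      rw [szegoMoment_succ, eq_neg_of_add_eq_zero_right this]
      congr 1
      exact Finset.sum_congr rfl fun j hj => by rw [ih j (Finset.mem_range.1 hj)]

/-! ### Comparison of Taylor coefficients -/

theorem iteratedDeriv_polynomial_eval (P : ℂ[X]) (n : ℕ) :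
    iteratedDeriv n (fun z => P.eval z) = fun z => (derivative^[n] P).eval z := by
  induction n generalizing P with
  | zero => simp
  | succ n ih =>
    have : deriv (fun z => P.eval z) = fun z => (derivative P).eval z := by
      ext z; exact P.deriv
    rw [iteratedDeriv_succ', this, ih, Function.iterate_succ_apply]

theorem iteratedDeriv_polynomial_eval_zero (P : ℂ[X]) (n : ℕ) :
    iteratedDeriv n (fun z => P.eval z) 0 = n.factorial * P.coeff n := by
  simp only [iteratedDeriv_polynomial_eval]
  rw [← coeff_zero_eq_eval_zero, coeff_iterate_derivative]
  simp [Nat.descFactorial_self]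

/-- If `F P - Q` vanishes to order `m` at `0`, then the Taylor coefficients of `F P` and `Q` below
`m` agree. -/
theorem coeff_eq_sum_of_eventuallyEq_pow_mul {F h : ℂ → ℂ} (hF : AnalyticAt ℂ F 0)
    (hh : AnalyticAt ℂ h 0) (P Q : ℂ[X]) {m k : ℕ} (hk : k < m)
    (heq : ∀ᶠ z in 𝓝 (0 : ℂ), F z * P.eval z - Q.eval z = z ^ m * h z) :
    Q.coeff k = ∑ i ∈ Finset.range (k + 1),
      iteratedDeriv i F 0 / (i.factorial : ℂ) * P.coeff (k - i) := by
  have hP : AnalyticAt ℂ (fun z => P.eval z) 0 := P.differentiable.analyticAt 0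
  have hQ : AnalyticAt ℂ (fun z => Q.eval z) 0 := Q.differentiable.analyticAt 0
  have hA : AnalyticAt ℂ (fun z => F z * P.eval z - Q.eval z) 0 := (hF.mul hP).sub hQ
  have h1 := (natCast_le_analyticOrderAt_iff_iteratedDeriv_eq_zero hA).1
    ((natCast_le_analyticOrderAt hA).2 ⟨h, hh, by simpa using heq⟩) k hk
  rw [iteratedDeriv_fun_sub (hF.fun_mul hP).contDiffAt hQ.contDiffAt,
    iteratedDeriv_fun_mul hF.contDiffAt hP.contDiffAt, iteratedDeriv_polynomial_eval_zero,
    sub_eq_zero] at h1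
  have hk0 : (k.factorial : ℂ) ≠ 0 := by exact_mod_cast k.factorial_ne_zero
  apply mul_left_cancel₀ hk0
  rw [← h1, Finset.mul_sum]
  refine Finset.sum_congr rfl fun i hi => ?_
  have hik : i ≤ k := Nat.lt_succ_iff.1 (Finset.mem_range.1 hi)
  have hi0 : (i.factorial : ℂ) ≠ 0 := by exact_mod_cast i.factorial_ne_zero
  rw [iteratedDeriv_polynomial_eval_zero]
  have := Nat.choose_mul_factorial_mul_factorial hik
  rw [← this]
  push_cast
  field_simp

/-! ### The Carathéodory function of a Schur sequence -/

namespace IsSchurSequence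

variable {α : ℕ → ℂ} {N : ℕ} {f : ℕ → ℂ → ℂ}

theorem eventually_recursion (hf : IsSchurSequence α N f) (n : ℕ) :
    ∀ᶠ z in 𝓝[≠] (0 : ℂ),
      f n z = (α n + z * f (n + 1) z) / (1 + conj (α n) * z * f (n + 1) z) := by
  have hball : Metric.ball (0 : ℂ) 1 ∈ 𝓝[≠] (0 : ℂ) :=
    mem_nhdsWithin_of_mem_nhds (Metric.ball_mem_nhds _ one_pos)
  rcases lt_or_ge n N with hn | hn
  · have h := mem_codiscreteWithin_iff_forall_mem_nhdsNE.1 (hf.recursion_of_lt n hn) 0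
      (Metric.mem_ball_self one_pos)
    filter_upwards [h, hball] with z hz hz'
    exact hz.resolve_right fun h => h hz'
  · filter_upwards [hball] with z hz using hf.recursion n hn z hz

/-- The denominator of a Schur step equals `1` at `z = 0`, so no step below `N` creates a pole
there; only the value at `0` itself may be arbitrary. -/
theorem exists_analyticAt_eventuallyEq (hf : IsSchurSequence α N f) (n : ℕ) :
    ∃ g : ℂ → ℂ, AnalyticAt ℂ g 0 ∧ f n =ᶠ[𝓝[≠] 0] g := by
  rcases le_total N n with hn | hn
  · exact ⟨f n, (hf.differentiableOn n hn).analyticAt (Metric.ball_mem_nhds _ one_pos),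
      EventuallyEq.rfl⟩
  · induction hn using Nat.decreasingInduction with
    | self =>
      exact ⟨f N, (hf.differentiableOn N le_rfl).analyticAt (Metric.ball_mem_nhds _ one_pos),
        EventuallyEq.rfl⟩
    | of_succ n hn ih =>
      obtain ⟨g, hg, hfg⟩ := ih
      refine ⟨fun z => (α n + z * g z) / (1 + conj (α n) * z * g z), ?_, ?_⟩
      · exact AnalyticAt.fun_div (by fun_prop) (by fun_prop) (by simp)
      · filter_upwards [hf.eventually_recursion n, hfg] with z hz hz'
        rw [hz, hz']

theorem exists_analyticAt_recursion (hf : IsSchurSequence α N f) :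
    ∃ g : ℕ → ℂ → ℂ, (∀ n, AnalyticAt ℂ (g n) 0) ∧ (∀ n, f n =ᶠ[𝓝[≠] 0] g n) ∧
      ∀ n, ∀ᶠ z in 𝓝 (0 : ℂ),
        g n z - α n = z * g (n + 1) z * (1 - conj (α n) * g n z) := by
  choose g hg hfg using hf.exists_analyticAt_eventuallyEq
  refine ⟨g, hg, hfg, fun n => ?_⟩
  have h₀ := hg n
  have h₁ := hg (n + 1)
  refine (AnalyticAt.frequently_eq_iff_eventually_eq (by fun_prop) (by fun_prop)).1
    (Eventually.frequently ?_)
  have hne : ∀ᶠ z in 𝓝 (0 : ℂ), 1 + conj (α n) * z * g (n + 1) z ≠ 0 := by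
    refine ContinuousAt.eventually_ne ?_ (by simp)
    exact AnalyticAt.continuousAt (𝕜 := ℂ) (by fun_prop)
  filter_upwards [hf.eventually_recursion n, hfg n, hfg (n + 1),
    hne.filter_mono nhdsWithin_le_nhds] with z h1 h2 h3 h4
  rw [h2, h3, eq_div_iff h4] at h1
  linear_combination h1

/-- Near `0` the function `F` satisfies `F Φ_n + Ψ_n = O(z ^ n)` and
`F Φ_n^* - Ψ_n^* = O(z ^ (n + 1))`, where the `Ψ_n` are the polynomials of the second kind. -/
theorem exists_analyticAt_caratheodoryF (hf : IsSchurSequence α N f) :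
    AnalyticAt ℂ (caratheodoryF f) 0 ∧ ∀ n, ∃ h : ℂ → ℂ, AnalyticAt ℂ h 0 ∧
      ∀ᶠ z in 𝓝 (0 : ℂ), caratheodoryF f z * (szegoReverse n (szegoPoly α n)).eval z -
        (szegoReverse n (szegoPoly (-α) n)).eval z = z ^ (n + 1) * h z := by
  obtain ⟨g, hg, hfg, hrec⟩ := hf.exists_analyticAt_recursion
  have hg0 := hg 0
  have hF : caratheodoryF f =ᶠ[𝓝 0] fun z => (1 + z * g 0 z) / (1 - z * g 0 z) := by
    refine eventuallyEq_nhds_of_eventuallyEq_nhdsNE ?_ (by simp [caratheodoryF])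
    filter_upwards [hfg 0] with z hz
    rw [caratheodoryF, hz]
  have hFa : AnalyticAt ℂ (caratheodoryF f) 0 :=
    (AnalyticAt.fun_div (by fun_prop) (by fun_prop) (by simp)).congr hF.symm
  refine ⟨hFa, ?_⟩
  -- The induction needs both relations with the same `a`: the recursion of `g` absorbs the extra
  -- factor `z`, and `a` gets multiplied by `1 - conj (α n) * g n`.
  have key : ∀ n, ∃ a : ℂ → ℂ, AnalyticAt ℂ a 0 ∧ ∀ᶠ z in 𝓝 (0 : ℂ),
      caratheodoryF f z * (szegoPoly α n).eval z + (szegoPoly (-α) n).eval z = z ^ n * a z ∧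
      caratheodoryF f z * (szegoReverse n (szegoPoly α n)).eval z -
        (szegoReverse n (szegoPoly (-α) n)).eval z = z ^ (n + 1) * (g n z * a z) := by
    intro n
    induction n with
    | zero =>
      refine ⟨fun z => caratheodoryF f z + 1, by fun_prop, ?_⟩
      have hne : ∀ᶠ z in 𝓝 (0 : ℂ), 1 - z * g 0 z ≠ 0 := by
        refine ContinuousAt.eventually_ne ?_ (by simp)
        exact AnalyticAt.continuousAt (𝕜 := ℂ) (by fun_prop)
      filter_upwards [hF, hne] with z hz hz'
      simp only [szegoPoly, szegoReverse, Polynomial.map_one, reflect_one, pow_zero, eval_one,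
        hz]
      constructor
      · ring
      · field_simp
        ring
    | succ n ih =>
      obtain ⟨a, ha, hev⟩ := ih
      have hgn := hg n
      refine ⟨fun z => a z * (1 - conj (α n) * g n z), by fun_prop, ?_⟩
      filter_upwards [hev, hrec n] with z hz hr
      obtain ⟨h1, h2⟩ := hz
      rw [szegoReverse_szegoPoly_succ, szegoReverse_szegoPoly_succ, szegoPoly, szegoPoly]
      simp only [eval_sub, eval_mul, eval_X, eval_C, eval_neg, Pi.neg_apply, map_neg]
      constructor
      · linear_combination z * h1 - conj (α n) * h2
      · linear_combination h2 - α n * z * h1 + z ^ (n + 1) * a z * hr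
  intro n
  obtain ⟨a, ha, hev⟩ := key n
  have hgn := hg n
  exact ⟨fun z => g n z * a z, by fun_prop, hev.mono fun z hz => hz.2⟩

theorem caratheodoryF_zero (f : ℕ → ℂ → ℂ) : caratheodoryF f 0 = 1 := by
  simp [caratheodoryF]

theorem iteratedDeriv_caratheodoryF (hf : IsSchurSequence α N f) {n : ℕ} (hn : 1 ≤ n) :
    iteratedDeriv n (caratheodoryF f) 0 / (n.factorial : ℂ) = 2 * conj (szegoMoment α n) := by
  obtain ⟨hF, hO⟩ := hf.exists_analyticAt_caratheodoryF
  set c : ℕ → ℂ := fun i => iteratedDeriv i (caratheodoryF f) 0 / (i.factorial : ℂ) with hc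
  have hc0 : c 0 = 1 := by simp [hc, caratheodoryF]
  -- Index `0` is not halved: the expected expansion is `F = 1 + 2 ∑ μ(z^(-n)) z^n`.
  let m : ℕ → ℂ := fun j => if j = 0 then 1 else conj (c j) / 2
  have hm : m n = szegoMoment α n := by
    refine eq_szegoMoment (by simp [m]) (fun k => ?_) n
    obtain ⟨h, hh, heq⟩ := hO (k + 1)
    have h1 := coeff_eq_sum_of_eventuallyEq_pow_mul hF hh _ _ (k + 1).lt_succ_self heq
    have h2 : ∀ i ∈ Finset.range (k + 1 + 1),
        c i * (szegoReverse (k + 1) (szegoPoly α (k + 1))).coeff (k + 1 - i) =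
          c i * conj ((szegoPoly α (k + 1)).coeff i) := fun i hi => by
      rw [coeff_szegoReverse (Nat.sub_le _ _),
        Nat.sub_sub_self (Nat.lt_succ_iff.1 (Finset.mem_range.1 hi))]
    -- The constant coefficients for `α` and `-α` are opposite, so moving one across doubles the `i
    -- = 0` term and makes up for the missing half.
    rw [Finset.sum_congr rfl h2, coeff_szegoReverse le_rfl, Nat.sub_self,
      coeff_zero_szegoPoly_succ, Finset.sum_range_succ', hc0, coeff_zero_szegoPoly_succ] at h1
    have h3 := congrArg (starRingEnd ℂ) h1
    simp only [map_neg, Pi.neg_apply, Complex.conj_conj, map_add, map_sum, map_mul,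
      one_mul, neg_neg] at h3
    rw [Finset.sum_range_succ', coeff_zero_szegoPoly_succ]
    have h4 : ∀ i ∈ Finset.range (k + 1), (szegoPoly α (k + 1)).coeff (i + 1) * m (i + 1) =
        conj (c (i + 1)) * (szegoPoly α (k + 1)).coeff (i + 1) * 2⁻¹ := fun i _ => by
      simp only [m, if_neg i.succ_ne_zero]
      ring
    rw [Finset.sum_congr rfl h4, ← Finset.sum_mul]
    simp only [m, if_true]
    linear_combination -h3 / 2
  have hn0 : n ≠ 0 := by omega
  change c n = _
  rw [← hm]
  simp only [m, if_neg hn0, map_div₀, Complex.conj_conj, map_ofNat]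
  ring

end IsSchurSequence

/-! ### Cauchy estimates and the root bound -/

theorem AnalyticAt.exists_norm_iteratedDeriv_div_factorial_le {F : ℂ → ℂ} (hF : AnalyticAt ℂ F 0) :
    ∃ C R : ℝ, 1 ≤ C ∧ 0 < R ∧
      ∀ n : ℕ, ‖iteratedDeriv n F 0 / (n.factorial : ℂ)‖ ≤ C / R ^ n := by
  obtain ⟨R, hR, hball⟩ := Metric.nhds_basis_closedBall.eventually_iff.1 hF.eventually_analyticAt
  have hcont : ContinuousOn F (Metric.closedBall 0 R) := fun z hz =>
    (hball hz).continuousAt.continuousWithinAt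
  obtain ⟨C, hC⟩ := (isCompact_closedBall (0 : ℂ) R).exists_bound_of_continuousOn hcont
  -- A constant at least `1` can later be replaced by its `n`-th power.
  refine ⟨max C 1, R, le_max_right _ _, hR, fun n => ?_⟩
  have hd : DiffContOnCl ℂ F (Metric.ball 0 R) := by
    refine DifferentiableOn.diffContOnCl fun z hz => ?_
    exact (hball (Metric.closure_ball_subset_closedBall hz)).differentiableAt.differentiableWithinAt
  have h := Complex.norm_iteratedDeriv_le_of_forall_mem_sphere_norm_le n hR hd
    fun z hz => (hC z (Metric.sphere_subset_closedBall hz)).trans (le_max_left C 1)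
  have hn : (0 : ℝ) < n.factorial := by exact_mod_cast n.factorial_pos
  rw [norm_div, Complex.norm_natCast, div_le_iff₀ hn]
  exact h.trans_eq (by ring)

theorem limsup_rpow_lt_top_of_le {u : ℕ → ℝ} {C R : ℝ} (hu : ∀ n, 0 ≤ u n) (hC : 1 ≤ C)
    (hR : 0 < R) (h : ∀ n, 1 ≤ n → u n ≤ C / R ^ n) :
    limsup (fun n : ℕ => ((u n ^ (1 / (n : ℝ)) : ℝ) : EReal)) atTop < ⊤ := by
  refine lt_of_le_of_lt (limsup_le_of_le (a := ((C / R : ℝ) : EReal)) (h := ?_))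
    (EReal.coe_lt_top _)
  filter_upwards [eventually_ge_atTop 1] with n hn
  rw [EReal.coe_le_coe_iff]
  have hn' : (n : ℝ) ≠ 0 := by exact_mod_cast (by omega : n ≠ 0)
  have hle : u n ≤ (C / R) ^ n := by
    refine (h n hn).trans ?_
    rw [div_pow]
    gcongr
    exact le_self_pow₀ hC (by omega)
  calc u n ^ (1 / (n : ℝ)) ≤ ((C / R) ^ n) ^ (1 / (n : ℝ)) :=
        Real.rpow_le_rpow (hu n) hle (by positivity)
    _ = C / R := by
        rw [one_div, Real.pow_rpow_inv_natCast (by positivity) (by omega)]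

/-! ### Existence of Schur sequences -/

noncomputable section

/-- The map `w ↦ (a + z w) / (1 + conj a z w)` of one step of the Schur algorithm. -/
def schurStep (a z w : ℂ) : ℂ := (a + z * w) / (1 + conj a * z * w)

theorem one_add_conj_mul_ne_zero {a u : ℂ} (ha : ‖a‖ < 1) (hu : ‖u‖ ≤ 1) :
    1 + conj a * u ≠ 0 := by
  intro h
  have h1 : ‖conj a * u‖ = 1 := by
    rw [eq_neg_of_add_eq_zero_right h, norm_neg, norm_one]
  rw [norm_mul, RCLike.norm_conj] at h1
  nlinarith [norm_nonneg a, norm_nonneg u]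

theorem normSq_one_add_conj_mul_sub (a u : ℂ) :
    ‖1 + conj a * u‖ ^ 2 - ‖a + u‖ ^ 2 = (1 - ‖a‖ ^ 2) * (1 - ‖u‖ ^ 2) := by
  simp only [← Complex.normSq_eq_norm_sq, Complex.normSq_apply, Complex.add_re, Complex.add_im,
    Complex.mul_re, Complex.mul_im, Complex.conj_re, Complex.conj_im, Complex.one_re,
    Complex.one_im]
  ring

theorem norm_mobius_le_one {a u : ℂ} (ha : ‖a‖ < 1) (hu : ‖u‖ ≤ 1) :
    ‖(a + u) / (1 + conj a * u)‖ ≤ 1 := by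
  rw [norm_div]
  refine div_le_one_of_le₀ ?_ (norm_nonneg _)
  refine (sq_le_sq₀ (norm_nonneg _) (norm_nonneg _)).1 ?_
  have h := normSq_one_add_conj_mul_sub a u
  have h1 : 0 ≤ (1 - ‖a‖ ^ 2) * (1 - ‖u‖ ^ 2) :=
    mul_nonneg (by nlinarith [norm_nonneg a]) (by nlinarith [norm_nonneg u])
  linarith

theorem norm_schurStep_le_one {a z w : ℂ} (ha : ‖a‖ < 1) (hz : ‖z‖ ≤ 1) (hw : ‖w‖ ≤ 1) :
    ‖schurStep a z w‖ ≤ 1 := by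
  rw [schurStep, mul_assoc]
  exact norm_mobius_le_one ha (by rw [norm_mul]; exact mul_le_one₀ hz (norm_nonneg _) hw)

/-- Disk automorphisms preserve bounds on the pseudo-hyperbolic distance. -/
theorem norm_mobius_sub_le {a u v : ℂ} {c : ℝ} (ha : ‖a‖ < 1) (hu : ‖u‖ ≤ 1) (hv : ‖v‖ ≤ 1)
    (h : ‖u - v‖ ≤ c * ‖1 - conj u * v‖) :
    ‖(a + u) / (1 + conj a * u) - (a + v) / (1 + conj a * v)‖ ≤
      c * ‖1 - conj ((a + u) / (1 + conj a * u)) * ((a + v) / (1 + conj a * v))‖ := by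
  have hu0 := one_add_conj_mul_ne_zero ha hu
  have hv0 := one_add_conj_mul_ne_zero ha hv
  have hu1 : 1 + a * conj u ≠ 0 := by
    intro h
    apply hu0
    simpa using congrArg (starRingEnd ℂ) h
  have e1 : (a + u) / (1 + conj a * u) - (a + v) / (1 + conj a * v) =
      (1 - a * conj a) * (u - v) / ((1 + conj a * u) * (1 + conj a * v)) := by
    rw [div_sub_div _ _ hu0 hv0]
    congr 1
    ring
  have e2 : 1 - conj ((a + u) / (1 + conj a * u)) * ((a + v) / (1 + conj a * v)) =
      (1 - a * conj a) * (1 - conj u * v) / ((1 + a * conj u) * (1 + conj a * v)) := by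
    simp only [map_div₀, map_add, map_mul, map_one, Complex.conj_conj]
    rw [div_mul_div_comm, one_sub_div (mul_ne_zero hu1 hv0)]
    congr 1
    ring
  have e3 : ‖1 + a * conj u‖ = ‖1 + conj a * u‖ := by
    rw [← RCLike.norm_conj (1 + conj a * u)]
    simp
  rw [e1, e2, norm_div, norm_div, norm_mul, norm_mul, norm_mul, norm_mul, e3, ← mul_div_assoc]
  refine div_le_div_of_nonneg_right ?_ (by positivity)
  nlinarith [norm_nonneg (1 - a * conj a)]

/-- Gives the contraction factor `2r / (1 + r^2)` of `w ↦ z w`, `|z| = r`; equality at `u = -1`. -/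
theorem norm_one_sub_le {u : ℂ} (hu : ‖u‖ ≤ 1) {r : ℝ} (hr : r ^ 2 ≤ 1) :
    (1 + r ^ 2) * ‖1 - u‖ ≤ 2 * ‖1 - (r : ℂ) ^ 2 * u‖ := by
  have hp : u.re ^ 2 + u.im ^ 2 ≤ 1 := by
    have h : ‖u‖ ^ 2 ≤ 1 := pow_le_one₀ (norm_nonneg u) hu
    rw [← Complex.normSq_eq_norm_sq, Complex.normSq_apply] at h
    linarith
  have hx : -(1 + (u.re ^ 2 + u.im ^ 2)) ≤ 2 * u.re := by nlinarith [sq_nonneg (u.re + 1)]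
  refine (sq_le_sq₀ (by positivity) (by positivity)).1 ?_
  rw [mul_pow, mul_pow, ← Complex.normSq_eq_norm_sq, ← Complex.normSq_eq_norm_sq,
    ← Complex.ofReal_pow]
  simp only [Complex.normSq_apply, Complex.sub_re, Complex.sub_im, Complex.one_re, Complex.one_im,
    Complex.re_ofReal_mul, Complex.im_ofReal_mul]
  have hs := sq_nonneg r
  generalize r ^ 2 = s at *
  -- With `p = |u|^2`, the difference of squares is `(1-s)^2 (1 + p + 2 Re u) + 2 (1-s^2) (1-p)`.
  have h1 := mul_le_mul_of_nonneg_right hx (sq_nonneg (1 - s))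
  have h2 : 0 ≤ 1 - s ^ 2 := by nlinarith
  nlinarith [mul_nonneg h2 (sub_nonneg.2 hp)]

/-- One step of the Schur algorithm contracts the pseudo-hyperbolic distance. -/
theorem norm_schurStep_sub_le {a z w w' : ℂ} {c R : ℝ} (ha : ‖a‖ < 1) (hz : ‖z‖ ≤ R) (hR : R < 1)
    (hw : ‖w‖ ≤ 1) (hw' : ‖w'‖ ≤ 1) (h : ‖w - w'‖ ≤ c * ‖1 - conj w * w'‖) (hc : 0 ≤ c) :
    ‖schurStep a z w - schurStep a z w'‖ ≤
      (2 * R / (1 + R ^ 2)) * c * ‖1 - conj (schurStep a z w) * schurStep a z w'‖ := by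
  have hz1 : ‖z‖ ≤ 1 := hz.trans hR.le
  simp only [schurStep, mul_assoc (conj a)]
  refine norm_mobius_sub_le ha ?_ ?_ ?_
  · rw [norm_mul]; exact mul_le_one₀ hz1 (norm_nonneg _) hw
  · rw [norm_mul]; exact mul_le_one₀ hz1 (norm_nonneg _) hw'
  · have e : conj (z * w) * (z * w') = (‖z‖ : ℂ) ^ 2 * (conj w * w') := by
      rw [← Complex.conj_mul', map_mul]
      ring
    have h1 := norm_one_sub_le (u := conj w * w')
      (by rw [norm_mul, RCLike.norm_conj]; exact mul_le_one₀ hw (norm_nonneg _) hw')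
      (r := ‖z‖) (pow_le_one₀ (norm_nonneg z) hz1)
    have hR0 : 0 ≤ R := (norm_nonneg z).trans hz
    -- `t / (1 + t^2)` increases on `[0, 1]`: `R (1 + t^2) - t (1 + R^2) = (R - t) (1 - R t)`.
    have h2 : ‖z‖ ≤ R / (1 + R ^ 2) * (1 + ‖z‖ ^ 2) := by
      rw [div_mul_eq_mul_div, le_div_iff₀ (by positivity)]
      nlinarith [mul_nonneg (sub_nonneg.2 hz)
        (sub_nonneg.2 (mul_le_one₀ hz1 hR0 hR.le))]
    rw [e, ← mul_sub, norm_mul]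
    calc ‖z‖ * ‖w - w'‖ ≤ (R / (1 + R ^ 2) * (1 + ‖z‖ ^ 2)) * (c * ‖1 - conj w * w'‖) := by
          gcongr
      _ = R / (1 + R ^ 2) * c * ((1 + ‖z‖ ^ 2) * ‖1 - conj w * w'‖) := by ring
      _ ≤ R / (1 + R ^ 2) * c * (2 * ‖1 - (‖z‖ : ℂ) ^ 2 * (conj w * w')‖) := by
          gcongr
      _ = _ := by ring

/-- The Schur approximants: `m` steps of the Schur algorithm with the parameters
`a n, …, a (n + m - 1)`, started at `0`. -/
def schurApprox (a : ℕ → ℂ) : ℕ → ℕ → ℂ → ℂ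
  | 0, _, _ => 0
  | m + 1, n, z => schurStep (a n) z (schurApprox a m (n + 1) z)

section Approximants

variable {a : ℕ → ℂ} {N : ℕ}

theorem norm_schurApprox_le_one (ha : ∀ n, N ≤ n → ‖a n‖ < 1) (m : ℕ) {n : ℕ} (hn : N ≤ n) {z : ℂ}
    (hz : ‖z‖ ≤ 1) : ‖schurApprox a m n z‖ ≤ 1 := by
  induction m generalizing n with
  | zero => simp [schurApprox]
  | succ m ih => exact norm_schurStep_le_one (ha n hn) hz (ih (hn.trans n.le_succ))

theorem differentiableOn_schurApprox (ha : ∀ n, N ≤ n → ‖a n‖ < 1) (m : ℕ) {n : ℕ} (hn : N ≤ n) :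
    DifferentiableOn ℂ (schurApprox a m n) (Metric.ball 0 1) := by
  induction m generalizing n with
  | zero => exact differentiableOn_const 0
  | succ m ih =>
    have h := ih (hn.trans n.le_succ)
    refine DifferentiableOn.fun_div (by fun_prop) (by fun_prop) fun z hz => ?_
    have hz' : ‖z‖ ≤ 1 := (mem_ball_zero_iff.1 hz).le
    rw [mul_assoc]
    refine one_add_conj_mul_ne_zero (ha n hn) ?_
    rw [norm_mul]
    exact mul_le_one₀ hz' (norm_nonneg _) (norm_schurApprox_le_one ha m (hn.trans n.le_succ) hz')

theorem norm_schurApprox_sub_le (ha : ∀ n, N ≤ n → ‖a n‖ < 1) (m : ℕ) {n : ℕ} (hn : N ≤ n) {z : ℂ}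
    {R : ℝ} (hz : ‖z‖ ≤ R) (hR : R < 1) :
    ‖schurApprox a (m + 1) n z - schurApprox a m n z‖ ≤ (2 * R / (1 + R ^ 2)) ^ m * 2 := by
  have hR0 : 0 ≤ R := (norm_nonneg z).trans hz
  have hz1 : ‖z‖ ≤ 1 := hz.trans hR.le
  -- The bound is kept division-free, since `1 - conj u * v` may vanish on the unit circle.
  have key : ∀ m n, N ≤ n → ‖schurApprox a (m + 1) n z - schurApprox a m n z‖ ≤
      (2 * R / (1 + R ^ 2)) ^ m *
        ‖1 - conj (schurApprox a (m + 1) n z) * schurApprox a m n z‖ := by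
    intro m
    induction m with
    | zero =>
      intro n hn
      simpa [schurApprox] using norm_schurApprox_le_one ha 1 hn hz1
    | succ m ih =>
      intro n hn
      have hn' := hn.trans n.le_succ
      rw [pow_succ']
      exact norm_schurStep_sub_le (ha n hn) hz hR (norm_schurApprox_le_one ha _ hn' hz1)
        (norm_schurApprox_le_one ha _ hn' hz1) (ih (n + 1) hn') (by positivity)
  refine (key m n hn).trans (mul_le_mul_of_nonneg_left ?_ (by positivity))
  refine (norm_sub_le _ _).trans ?_
  rw [norm_one, norm_mul, RCLike.norm_conj]
  linarith [mul_le_one₀ (norm_schurApprox_le_one ha (m + 1) hn hz1) (norm_nonneg _)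
    (norm_schurApprox_le_one ha m hn hz1)]

theorem summable_two_mul_div_pow {R : ℝ} (hR0 : 0 ≤ R) (hR : R < 1) :
    Summable fun m : ℕ => (2 * R / (1 + R ^ 2)) ^ m * 2 := by
  refine (summable_geometric_of_lt_one (by positivity) ?_).mul_right 2
  rw [div_lt_one (by positivity)]
  nlinarith [sq_pos_of_pos (sub_pos.2 hR)]

/-- The function with the Schur parameters `a n, a (n + 1), …`. -/
def schurFunction (a : ℕ → ℂ) (n : ℕ) (z : ℂ) : ℂ :=
  ∑' m, (schurApprox a (m + 1) n z - schurApprox a m n z)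

theorem tendsto_schurApprox (ha : ∀ n, N ≤ n → ‖a n‖ < 1) {n : ℕ} (hn : N ≤ n) {z : ℂ}
    (hz : ‖z‖ < 1) :
    Tendsto (fun m => schurApprox a m n z) atTop (𝓝 (schurFunction a n z)) := by
  have hs : Summable fun m => schurApprox a (m + 1) n z - schurApprox a m n z :=
    (summable_two_mul_div_pow (norm_nonneg z) hz).of_norm_bounded
      fun m => norm_schurApprox_sub_le ha m hn le_rfl hz
  refine hs.hasSum.tendsto_sum_nat.congr fun m => ?_
  rw [Finset.sum_range_sub (fun m => schurApprox a m n z)]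
  simp [schurApprox]

theorem norm_schurFunction_le_one (ha : ∀ n, N ≤ n → ‖a n‖ < 1) {n : ℕ} (hn : N ≤ n) {z : ℂ}
    (hz : ‖z‖ < 1) : ‖schurFunction a n z‖ ≤ 1 :=
  le_of_tendsto (tendsto_schurApprox ha hn hz).norm
    (Eventually.of_forall fun m => norm_schurApprox_le_one ha m hn hz.le)

theorem schurFunction_eq_schurStep (ha : ∀ n, N ≤ n → ‖a n‖ < 1) {n : ℕ} (hn : N ≤ n) {z : ℂ}
    (hz : ‖z‖ < 1) :
    schurFunction a n z = schurStep (a n) z (schurFunction a (n + 1) z) := by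
  have hn' := hn.trans n.le_succ
  have h1 := (tendsto_schurApprox ha hn hz).comp (tendsto_add_atTop_nat 1)
  have h2 := tendsto_schurApprox ha hn' hz
  refine tendsto_nhds_unique h1 (Tendsto.div ((h2.const_mul z).const_add (a n))
    ((h2.const_mul (conj (a n) * z)).const_add 1) ?_)
  rw [mul_assoc]
  refine one_add_conj_mul_ne_zero (ha n hn) ?_
  rw [norm_mul]
  exact mul_le_one₀ hz.le (norm_nonneg _) (norm_schurFunction_le_one ha hn' hz)

theorem differentiableOn_schurFunction (ha : ∀ n, N ≤ n → ‖a n‖ < 1) {n : ℕ} (hn : N ≤ n) :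
    DifferentiableOn ℂ (schurFunction a n) (Metric.ball 0 1) := by
  intro z hz
  rw [mem_ball_zero_iff] at hz
  -- The geometric majorant is uniform only on smaller disks.
  obtain ⟨R, hzR, hR⟩ := exists_between hz
  have hsub : Metric.ball (0 : ℂ) R ⊆ Metric.ball 0 1 := Metric.ball_subset_ball hR.le
  have h : DifferentiableOn ℂ (schurFunction a n) (Metric.ball 0 R) :=
    Complex.differentiableOn_tsum_of_summable_norm
      (summable_two_mul_div_pow ((norm_nonneg z).trans hzR.le) hR)
      (fun m => ((differentiableOn_schurApprox ha (m + 1) hn).sub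
        (differentiableOn_schurApprox ha m hn)).mono hsub) Metric.isOpen_ball
      fun m w hw => norm_schurApprox_sub_le ha m hn (mem_ball_zero_iff.1 hw).le hR
  exact (h.differentiableAt (Metric.isOpen_ball.mem_nhds
    (mem_ball_zero_iff.2 hzR))).differentiableWithinAt

end Approximants

/-- The functions obtained from the `N`-th Schur function by `k` steps of the Schur algorithm with
the parameters `a (N - 1), a (N - 2), …, a (N - k)`. -/
def schurExtension (a : ℕ → ℂ) (N : ℕ) : ℕ → ℂ → ℂ
  | 0, z => schurFunction a N z
  | k + 1, z => schurStep (a (N - (k + 1))) z (schurExtension a N k z)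

theorem meromorphicOn_schurExtension {a : ℕ → ℂ} {N : ℕ} (ha : ∀ n, N ≤ n → ‖a n‖ < 1) (k : ℕ) :
    MeromorphicOn (schurExtension a N k) (Metric.ball 0 1) := by
  intro z hz
  induction k with
  | zero =>
    exact ((differentiableOn_schurFunction ha le_rfl).analyticAt
      (Metric.isOpen_ball.mem_nhds hz)).meromorphicAt
  | succ k ih =>
    have hid : MeromorphicAt (fun z : ℂ => z) z := analyticAt_id.meromorphicAt
    exact ((MeromorphicAt.const (a (N - (k + 1))) z).fun_add (hid.fun_mul ih)).fun_div
      ((MeromorphicAt.const 1 z).fun_add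
        (((MeromorphicAt.const (conj (a (N - (k + 1)))) z).fun_mul hid).fun_mul ih))

theorem exists_isSchurSequence {α : ℕ → ℂ} {N : ℕ} (hα : IsAdmissibleVerblunsky α N) :
    ∃ f : ℕ → ℂ → ℂ, IsSchurSequence α N f := by
  have ha := hα.2
  let f : ℕ → ℂ → ℂ := fun n => if N ≤ n then schurFunction α n else schurExtension α N (N - n)
  have hf : ∀ n, N ≤ n → f n = schurFunction α n := fun n hn => if_pos hn
  have hf' : ∀ n, n ≤ N → f n = schurExtension α N (N - n) := fun n hn => by
    rcases hn.lt_or_eq with h | rfl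
    · exact if_neg h.not_ge
    · rw [hf _ le_rfl, Nat.sub_self]
      rfl
  refine ⟨f, ?_, ?_, ?_, ?_, ?_⟩
  · intro n hn
    rw [hf n hn]
    exact differentiableOn_schurFunction ha hn
  · intro n hn z hz
    rw [hf n hn]
    exact norm_schurFunction_le_one ha hn (mem_ball_zero_iff.1 hz)
  · intro n hn z hz
    rw [hf n hn, hf (n + 1) (hn.trans n.le_succ)]
    exact schurFunction_eq_schurStep ha hn (mem_ball_zero_iff.1 hz)
  · intro n hn
    rw [hf' n hn.le]
    exact meromorphicOn_schurExtension ha _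
  · intro n hn
    -- Below `N` the relation is the definition, so it holds even where the denominator vanishes.
    refine Eventually.of_forall fun z => ?_
    obtain ⟨k, rfl⟩ : ∃ k, N = n + (k + 1) := ⟨N - n - 1, by omega⟩
    have h1 : n + (k + 1) - n = k + 1 := by omega
    have h2 : n + (k + 1) - (n + 1) = k := by omega
    have h3 : n + (k + 1) - (k + 1) = n := by omega
    rw [hf' n (by omega), hf' (n + 1) (by omega), h1, h2, schurExtension, h3]
    rfl

end

theorem mainTheorem10 (α : ℕ → ℂ) (N : ℕ) (hα : IsAdmissibleVerblunsky α N) :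
    limsup (fun n : ℕ => ((‖szegoFunctional α (T (n : ℤ))‖ ^ (1 / (n : ℝ)) : ℝ) : EReal)) atTop < ⊤ ∧
    (∃ f : ℕ → ℂ → ℂ, IsSchurSequence α N f) ∧
    ∀ f : ℕ → ℂ → ℂ, IsSchurSequence α N f →
      AnalyticAt ℂ (caratheodoryF f) 0 ∧
      caratheodoryF f 0 = 1 ∧
      ∀ n : ℕ, 1 ≤ n →
        iteratedDeriv n (caratheodoryF f) 0 / (n.factorial : ℂ) =
          2 * szegoFunctional α (T (-(n : ℤ))) := by
  have hμ : ∀ n : ℕ, szegoFunctional α (T (n : ℤ)) = szegoMoment α n := fun n =>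
    szegoFunctional_T α n
  refine ⟨?_, exists_isSchurSequence hα, fun f hf => ⟨hf.exists_analyticAt_caratheodoryF.1,
    IsSchurSequence.caratheodoryF_zero f, fun n hn => ?_⟩⟩
  · obtain ⟨f, hf⟩ := exists_isSchurSequence hα
    obtain ⟨C, R, hC, hR, h⟩ :=
      hf.exists_analyticAt_caratheodoryF.1.exists_norm_iteratedDeriv_div_factorial_le
    refine limsup_rpow_lt_top_of_le (fun n => norm_nonneg _) hC hR fun n hn => ?_
    have h1 := h n
    rw [hf.iteratedDeriv_caratheodoryF hn, norm_mul, RCLike.norm_conj, Complex.norm_ofNat] at h1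
    rw [hμ]
    linarith [norm_nonneg (szegoMoment α n)]
  · rw [szegoFunctional_T_neg α n hn, hμ, hf.iteratedDeriv_caratheodoryF hn]
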